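/- Let $X$ be a finite non-empty unordered set of locations (a partially ordered set with trivial order) with possibly dependent Bernoulli random variables $\beta_x$ ($x\in X$) on a probability space. For $S\subset X$ let $Pr(S)=P(\beta_x=1\text{ for all }x\in S)$ and $Pr(S|T)=Pr(S\cup T)/Pr(T)$, and assume that $Pr(x,y)>0$ for all $x,y\in X$. In the OSR game on a set $A$ of locations, Hider chooses $h\in A$ and Searcher chooses an injective order-reflecting sequence $\sigma(1),\dots,\sigma(n)$ in $A$ (for an unordered set: any injective sequence). Searcher receives $Pr(\{\sigma(1),\dots,\sigma(k)\})$ if $h=\sigma(k)$, and $0$ if $h$ is not in the sequence; Hider minimizes this payoff. The value is that of the mixed extension. Disjoint sets $A,B\subset X$ are co-independent, $A\Vert B$, if for all $A'\subset A$, $B'\subset B$, $a\in A$, $b\in B$ we have $Pr(A'|B')=Pr(A'|b)$ if $B'\neq\emptyset$, $Pr(B'|A')=Pr(B'|a)$ if $A'\ne\emptyset$, $Pr(A'|a,b)=Pr(A'|a)$ and $Pr(B'|a,b)=Pr(B'|b)$, whenever the conditioning events have positive probability. Assume that $X$ is completely reducible: every $Y\subset X$ with at least two elements is a disjoint union of two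 non-empty co-independent sets. Then $X$ has a decomposition into a binary tree with root $X$ whose leaves are the singletons $\{x\}$, $x\in X$, and in which every internal node $A_w$ has two children with $A_w=A_{w0}\Vert A_{w1}$. Consider any such decomposition, write $A_{\bar w}$ for the sibling of a node $A_w$ other than the root, and suppose that all Bayesian factors are at most one: $$\frac{Pr(a_{w0}|a_{\bar w})}{Pr(a_{w0}|a_{w1})}\le 1$$ for every internal node $A_w$ other than the root and all $a_{w0}\in A_{w0}$, $a_{w1}\in A_{w1}$, $a_{\bar w}\in A_{\bar w}$. For an internal node with children $A$ and $B$ and any $a\in A$, $b\in B$, let $p_A=Pr(A|b)$, $p_B=Pr(B|a)$, let $V_A$ be the value of the OSR game on $A$ under the conditional law $Pr(\cdot|b)$ and let $V_B$ be the value of the OSR game on $B$ under the conditional law $Pr(\cdot|a)$. Then Lidbetter's solution for trees solves the OSR game on $X$: 1. At each internal node there is a coin with odds $$\frac1{V_A}-\frac{p_B}{V_B}\;:\;\frac1{V_B}-\frac{p_A}{V_A}$$ (both terms are non-negative, and one coin serves all choices of $a,b$; for odds $0:0$ any coin is allowed). For every such choice of coins, the following random depth-first search is an optimal strategy of Searcher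 in the OSR game on $X$: independently at each internal node, the coin decides whether all of $A$ is searched before all of $B$, or all of $B$ before all of $A$. 2. At each internal node there is a coin with odds $$\frac{1-p_A}{V_A}\;:\;\frac{1-p_B}{V_B}$$ (in the same sense). For every such choice of coins, it is an optimal strategy of Hider in the OSR game on $X$ to go down the tree from the root to a leaf, where at each internal node the coin decides between $A$ and $B$, and to hide in that leaf. -/

import Mathlib

open MeasureTheory

noncomputable section

namespace SearchRescue

section Game

variable {Ω X : Type*} [MeasurableSpace Ω]

/-- The event that every search in `S` is successful; `β x ω = true` stands for `β_x = 1`. -/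
def success (β : X → Ω → Bool) (S : Finset X) : Set Ω :=
  {ω | ∀ x ∈ S, β x ω = true}

/-- `Pr(S)`. -/
def pr (μ : Measure Ω) (β : X → Ω → Bool) (S : Finset X) : ℝ :=
  μ.real (success β S)

/-- The law conditioned on all searches in `S` being successful. -/
def condLaw (μ : Measure Ω) (β : X → Ω → Bool) (S : Finset X) : Measure Ω :=
  ProbabilityTheory.cond μ (success β S)

/-- `Pr(S | T)`. -/
def condPr (μ : Measure Ω) (β : X → Ω → Bool) (S T : Finset X) : ℝ :=
  pr (condLaw μ β T) β S

/-- A pure strategy of Searcher in the OSR game on the locations `A`: an injective,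
order-reflecting sequence `σ(1), …, σ(n)` of elements of `A` (if `σ(i) < σ(j)` then `i < j`;
in other words, no later term is smaller than an earlier one). -/
def IsSearch [PartialOrder X] (A : Finset X) (σ : List X) : Prop :=
  σ.Nodup ∧ (∀ x ∈ σ, x ∈ A) ∧ σ.Pairwise (fun x y => ¬ y < x)

/-- The payoff `Π(σ, h) = Pr(σ([k]))`, with `k` minimal such that `h ∈ σ([k])`, and `0` if
`h` is not searched. (`List.idxOf` counts from `0`.) -/
def payoff [DecidableEq X] (μ : Measure Ω) (β : X → Ω → Bool) (σ : List X) (h : X) : ℝ :=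
  if h ∈ σ then pr μ β (σ.take (σ.idxOf h + 1)).toFinset else 0

/-- A mixed strategy over the pure strategies in `S`: a finitely supported probability
distribution on `S`. -/
def IsMixed {ι : Type*} (S : Set ι) (p : ι →₀ ℝ) : Prop :=
  (∀ i, 0 ≤ p i) ∧ (p.sum fun _ a => a) = 1 ∧ ∀ i ∈ p.support, i ∈ S

/-- The expected payoff of a mixed search against a pure hiding place. -/
def searchPayoff [DecidableEq X] (μ : Measure Ω) (β : X → Ω → Bool) (p : List X →₀ ℝ)
    (h : X) : ℝ :=
  p.sum fun σ a => a * payoff μ β σ h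

/-- The expected payoff of a pure search against a mixed hiding strategy. -/
def hidePayoff [DecidableEq X] (μ : Measure Ω) (β : X → Ω → Bool) (σ : List X)
    (y : X →₀ ℝ) : ℝ :=
  y.sum fun h a => a * payoff μ β σ h

/-- The value of the OSR game on the locations `A`: the largest expected payoff that Searcher
can guarantee against every hiding place. -/
def value [PartialOrder X] [DecidableEq X] (μ : Measure Ω) (β : X → Ω → Bool)
    (A : Finset X) : ℝ :=
  sSup {v | ∃ p, IsMixed {σ | IsSearch A σ} p ∧ ∀ h ∈ A, v ≤ searchPayoff μ β p h}

/-- `p` is an optimal mixed strategy of Searcher: it guarantees the value. -/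
def IsOptimalSearch [PartialOrder X] [DecidableEq X] (μ : Measure Ω) (β : X → Ω → Bool)
    (A : Finset X) (p : List X →₀ ℝ) : Prop :=
  IsMixed {σ | IsSearch A σ} p ∧ ∀ h ∈ A, value μ β A ≤ searchPayoff μ β p h

/-- `y` is an optimal mixed strategy of Hider: no search achieves more than the value. -/
def IsOptimalHide [PartialOrder X] [DecidableEq X] (μ : Measure Ω) (β : X → Ω → Bool)
    (A : Finset X) (y : X →₀ ℝ) : Prop :=
  IsMixed {h | h ∈ A} y ∧ ∀ σ, IsSearch A σ → hidePayoff μ β σ y ≤ value μ β A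

end Game

section Reducible

variable {Ω X : Type*} [MeasurableSpace Ω] [DecidableEq X]

/-- `A ∥ B`: the disjoint sets `A` and `B` are co-independent. A set that is conditioned upon
is non-empty, and an equation is required when its conditioning events have positive
probability. -/
def CoIndep (μ : Measure Ω) (β : X → Ω → Bool) (A B : Finset X) : Prop :=
  Disjoint A B ∧
  ∀ A' ⊆ A, ∀ B' ⊆ B, ∀ a ∈ A, ∀ b ∈ B,
    (B'.Nonempty → 0 < pr μ β B' → 0 < pr μ β {b} →
      condPr μ β A' B' = condPr μ β A' {b}) ∧
    (A'.Nonempty → 0 < pr μ β A' → 0 < pr μ β {a} →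
      condPr μ β B' A' = condPr μ β B' {a}) ∧
    (0 < pr μ β {a, b} → condPr μ β A' {a, b} = condPr μ β A' {a}) ∧
    (0 < pr μ β {a, b} → condPr μ β B' {a, b} = condPr μ β B' {b})

/-- `Y` is a disjoint union of two non-empty co-independent sets. -/
def Reducible (μ : Measure Ω) (β : X → Ω → Bool) (Y : Finset X) : Prop :=
  ∃ A B : Finset X, A.Nonempty ∧ B.Nonempty ∧ A ∪ B = Y ∧ CoIndep μ β A B

def CompletelyReducible (μ : Measure Ω) (β : X → Ω → Bool) (A : Finset X) : Prop :=
  ∀ Y ⊆ A, 2 ≤ Y.card → Reducible μ β Y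

/-- Binary trees with leaves labelled by locations. -/
inductive SplitTree (X : Type*) where
  | leaf (x : X) : SplitTree X
  | node (l r : SplitTree X) : SplitTree X

/-- The set `A_w` of locations below the node `w`, at which the given tree is rooted. -/
def SplitTree.leaves : SplitTree X → Finset X
  | .leaf x => {x}
  | .node l r => l.leaves ∪ r.leaves

/-- At every internal node `w` the split is co-independent: `A_w = A_{w0} ∥ A_{w1}`. -/
def SplitTree.IsCoIndep (μ : Measure Ω) (β : X → Ω → Bool) : SplitTree X → Prop
  | .leaf _ => True
  | .node l r => CoIndep μ β l.leaves r.leaves ∧ l.IsCoIndep μ β ∧ r.IsCoIndep μ β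

/-- The tree is a complete co-independent decomposition of `A`. -/
def IsDecomposition (μ : Measure Ω) (β : X → Ω → Bool) (A : Finset X)
    (T : SplitTree X) : Prop :=
  T.leaves = A ∧ T.IsCoIndep μ β

/-- The Bayesian factor `Pr(a_{w0} | a_{w̄}) / Pr(a_{w0} | a_{w1})` with `a₀ = a_{w0}`,
`a₁ = a_{w1}` and `c = a_{w̄}`. -/
def bayesFactor (μ : Measure Ω) (β : X → Ω → Bool) (a₀ a₁ c : X) : ℝ :=
  condPr μ β {a₀} {c} / condPr μ β {a₀} {a₁}

/-- The Bayesian factor of the node `w` at which the given tree is rooted is at most one, where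
`C = A_{w̄}` belongs to the sibling of `w`. A leaf has no such factor. -/
def SplitTree.EdgeLeOne (μ : Measure Ω) (β : X → Ω → Bool) (C : Finset X) :
    SplitTree X → Prop
  | .leaf _ => True
  | .node l r => ∀ a₀ ∈ l.leaves, ∀ a₁ ∈ r.leaves, ∀ c ∈ C, bayesFactor μ β a₀ a₁ c ≤ 1

/-- All Bayesian factors (of all internal nodes that have a sibling) are at most one. -/
def SplitTree.FactorsLeOne (μ : Measure Ω) (β : X → Ω → Bool) : SplitTree X → Prop
  | .leaf _ => True
  | .node l r => l.EdgeLeOne μ β r.leaves ∧ r.EdgeLeOne μ β l.leaves ∧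
      l.FactorsLeOne μ β ∧ r.FactorsLeOne μ β

end Reducible

section Solution

variable {Ω X : Type*} [MeasurableSpace Ω]

/-- A coin shows heads with probability `q` and has odds `s : t` for heads against tails.
For the odds `0 : 0` every coin is admitted. -/
def HasOdds (q s t : ℝ) : Prop :=
  0 ≤ s ∧ 0 ≤ t ∧ 0 ≤ q ∧ q ≤ 1 ∧ q * t = (1 - q) * s

/-- The value `V(A)` of the subgame below a node with set of locations `A`, if `b` is a location
below its sibling: the OSR game on `A` under the law `Pr(· | b)`. -/
def subValue [PartialOrder X] [DecidableEq X] (μ : Measure Ω) (β : X → Ω → Bool)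
    (A : Finset X) (b : X) : ℝ :=
  value (condLaw μ β {b}) β A

/-- The coins `q` of Searcher, one for each internal node of the tree. At a node with children
`A` and `B`, heads means that `A` is searched before `B`, and the odds are
`1 / V(A) - Pr(B) / V(B) : 1 / V(B) - Pr(A) / V(A)`, where `V(A)`, `Pr(A)` refer to the law
`Pr(· | b)` on `A`, and `V(B)`, `Pr(B)` to the law `Pr(· | a)` on `B`. -/
def SplitTree.SearchCoins [PartialOrder X] [DecidableEq X] (μ : Measure Ω)
    (β : X → Ω → Bool) (q : SplitTree X → ℝ) : SplitTree X → Prop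
  | .leaf _ => True
  | .node l r =>
      (∀ a ∈ l.leaves, ∀ b ∈ r.leaves,
        HasOdds (q (.node l r))
          (1 / subValue μ β l.leaves b - condPr μ β r.leaves {a} / subValue μ β r.leaves a)
          (1 / subValue μ β r.leaves a - condPr μ β l.leaves {b} / subValue μ β l.leaves b)) ∧
      l.SearchCoins μ β q ∧ r.SearchCoins μ β q

/-- The coins `q` of Hider, one for each internal node of the tree. At a node with children
`A` and `B`, heads means that Hider goes to `A`, and the odds are
`(1 - Pr(A)) / V(A) : (1 - Pr(B)) / V(B)`, with the same laws on `A` and `B`. -/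
def SplitTree.HideCoins [PartialOrder X] [DecidableEq X] (μ : Measure Ω)
    (β : X → Ω → Bool) (q : SplitTree X → ℝ) : SplitTree X → Prop
  | .leaf _ => True
  | .node l r =>
      (∀ a ∈ l.leaves, ∀ b ∈ r.leaves,
        HasOdds (q (.node l r))
          ((1 - condPr μ β l.leaves {b}) / subValue μ β l.leaves b)
          ((1 - condPr μ β r.leaves {a}) / subValue μ β r.leaves a)) ∧
      l.HideCoins μ β q ∧ r.HideCoins μ β q

/-- Draw a sequence from `p`, independently one from `p'`, and concatenate them. -/
def concatMix (p p' : List X →₀ ℝ) : List X →₀ ℝ :=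
  p.sum fun s a => p'.sum fun t b => Finsupp.single (s ++ t) (a * b)

/-- The random depth-first search: at each internal node an independent coin `q` decides which
of the two subtrees is completely searched first. -/
def SplitTree.depthFirst (q : SplitTree X → ℝ) : SplitTree X → (List X →₀ ℝ)
  | .leaf x => Finsupp.single [x] 1
  | .node l r =>
      q (.node l r) • concatMix (l.depthFirst q) (r.depthFirst q) +
      (1 - q (.node l r)) • concatMix (r.depthFirst q) (l.depthFirst q)

/-- The random descent: Hider goes down the tree to a leaf by tossing the coins `q`. -/
def SplitTree.descent (q : SplitTree X → ℝ) : SplitTree X → (X →₀ ℝ)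
  | .leaf x => Finsupp.single x 1
  | .node l r =>
      q (.node l r) • l.descent q + (1 - q (.node l r)) • r.descent q

end Solution

end SearchRescue

end

/-! Co-independence of `A` and `B` amounts to one constant `c > 0` with `Pr(A' ∪ B') = c Pr(A')
Pr(B')` for all non-empty parts (`CoIndep.exists_productRule`). Conditioning on a location of the
sibling therefore multiplies probabilities and values by `c`, and the odds at a node depend neither
on `a` nor on `b`. A Bayesian factor at most one says that the constant of the parent node is at
most that of the child.

The tree is solved by induction (`SplitTree.Solved.node`). Write `v`, `v'` for the values of `A`,
`B`, and `a = c Pr(A)`, `b = c Pr(B)`. Depth-first search yields at least `(q + (1 - q) b) v` on `A`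
and `((1 - q) + q a) v'` on `B`; Searcher's odds make both equal to a number `u`
(`exists_node_value`). No minimax theorem is needed: a search guaranteeing `u` and a hiding strategy
conceding at most `u` identify the value.

Hider's bound must cover searches that switch between `A` and `B`, so the induction carries a
stronger estimate: the payoff of a non-empty search `σ` is at most proportional to the loss `1 - c
Pr(σ)`, for every admissible `c` up to the constant at the root of the subtree. Such estimates
survive interleaving (`ProductRule.hidePayoff_le`). To use them in the children with the constant of
the parent is exactly what the factor assumption permits. -/

namespace SearchRescue

/-! ### Co-independence as a product rule -/

section Probability

variable {Ω X : Type*} [MeasurableSpace Ω] {μ : Measure Ω} {β : X → Ω → Bool}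

theorem measurableSet_success [Countable X] (hβ : ∀ x, Measurable (β x)) (S : Finset X) :
    MeasurableSet (success β S) := by
  have : success β S = ⋂ x ∈ S, β x ⁻¹' {true} := by
    ext ω
    simp [success]
  rw [this]
  exact Finset.measurableSet_biInter S fun x _ => hβ x (measurableSet_singleton true)

theorem pr_nonneg (S : Finset X) : 0 ≤ pr μ β S :=
  measureReal_nonneg

theorem pr_anti [IsFiniteMeasure μ] {S T : Finset X} (h : S ⊆ T) : pr μ β T ≤ pr μ β S :=
  measureReal_mono fun _ hω x hx => hω x (h hx)

variable [DecidableEq X]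

theorem condPr_eq [Countable X] (hβ : ∀ x, Measurable (β x)) (S T : Finset X) :
    condPr μ β S T = pr μ β (S ∪ T) / pr μ β T := by
  have h : success β T ∩ success β S = success β (S ∪ T) := by
    ext ω
    simp only [success, Set.mem_inter_iff, Set.mem_ofPred_eq, Finset.mem_union]
    constructor
    · rintro ⟨h1, h2⟩ x (hx | hx)
      exacts [h2 x hx, h1 x hx]
    · exact fun h => ⟨fun x hx => h x (Or.inr hx), fun x hx => h x (Or.inl hx)⟩
  rw [condPr, pr, condLaw, measureReal_def,
    ProbabilityTheory.cond_apply (measurableSet_success hβ T), h, ENNReal.toReal_mul,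
    ENNReal.toReal_inv, inv_mul_eq_div]
  rfl

/-- `Pr(A' ∪ B') = c Pr(A') Pr(B')` for all non-empty `A' ⊆ A` and `B' ⊆ B`. -/
def ProductRule (μ : Measure Ω) (β : X → Ω → Bool) (c : ℝ) (A B : Finset X) : Prop :=
  ∀ A' ⊆ A, ∀ B' ⊆ B, A'.Nonempty → B'.Nonempty →
    pr μ β (A' ∪ B') = c * pr μ β A' * pr μ β B'

theorem ProductRule.symm {c : ℝ} {A B : Finset X} (h : ProductRule μ β c A B) :
    ProductRule μ β c B A := by
  intro B' hB' A' hA' nB nA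
  rw [Finset.union_comm, h A' hA' B' hB' nA nB]
  ring

/-- Co-independence allows `B'` to be replaced by `b` and then `A'` by `a`, which reduces every
joint probability to `Pr(a, b)`; hence the value of `c`. -/
theorem CoIndep.exists_productRule [Countable X] [IsFiniteMeasure μ]
    (hβ : ∀ x, Measurable (β x)) (hpos : ∀ x y : X, 0 < pr μ β {x, y}) {A B : Finset X}
    (h : CoIndep μ β A B) (hA : A.Nonempty) (hB : B.Nonempty) :
    ∃ c, 0 < c ∧ ProductRule μ β c A B := by
  obtain ⟨a, ha⟩ := hA
  obtain ⟨b, hb⟩ := hB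
  have pa : 0 < pr μ β {a} := by simpa using hpos a a
  have pb : 0 < pr μ β {b} := by simpa using hpos b b
  refine ⟨pr μ β {a, b} / (pr μ β {a} * pr μ β {b}), div_pos (hpos a b) (mul_pos pa pb), ?_⟩
  intro A' hA' B' hB' nA nB
  -- Null sets cannot be conditioned upon; there both sides vanish by monotonicity.
  rcases (pr_nonneg (μ := μ) (β := β) B').eq_or_lt with h0 | pB
  · rw [← h0, mul_zero]
    exact le_antisymm (h0 ▸ pr_anti Finset.subset_union_right) (pr_nonneg _)
  rcases (pr_nonneg (μ := μ) (β := β) A').eq_or_lt with h0 | pA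
  · rw [← h0, mul_zero, zero_mul]
    exact le_antisymm (h0 ▸ pr_anti Finset.subset_union_left) (pr_nonneg _)
  have h1 := (h.2 A' hA' B' hB' a ha b hb).1 nB pB pb
  have h2 := (h.2 A' hA' {b} (by simpa using hb) a ha b hb).2.1 nA pA pa
  rw [condPr_eq hβ, condPr_eq hβ, div_eq_div_iff pB.ne' pb.ne'] at h1
  rw [condPr_eq hβ, condPr_eq hβ, div_eq_div_iff pA.ne' pa.ne', Finset.union_comm,
    Finset.union_comm {b} {a}, ← Finset.insert_eq] at h2
  field_simp
  linear_combination pr μ β {a} * h1 + pr μ β B' * h2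

theorem ProductRule.condPr_eq [Countable X] (hβ : ∀ x, Measurable (β x)) {c : ℝ}
    {A B : Finset X} (h : ProductRule μ β c A B) {S : Finset X} (hS : S ⊆ A)
    (nS : S.Nonempty) {b : X} (hb : b ∈ B) (pb : 0 < pr μ β {b}) :
    condPr μ β S {b} = c * pr μ β S := by
  rw [SearchRescue.condPr_eq hβ, h S hS {b} (by simpa using hb) nS (by simp)]
  field_simp

theorem ProductRule.mul_pr_le_one [IsFiniteMeasure μ] {c : ℝ} {A B : Finset X}
    (h : ProductRule μ β c A B) {S : Finset X} (hS : S ⊆ A) (nS : S.Nonempty) {b : X}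
    (hb : b ∈ B) (pb : 0 < pr μ β {b}) : c * pr μ β S ≤ 1 := by
  have h1 := h S hS {b} (by simpa using hb) nS (by simp)
  have h2 : pr μ β (S ∪ {b}) ≤ pr μ β {b} := pr_anti Finset.subset_union_right
  rw [h1] at h2
  exact (mul_le_iff_le_one_left pb).1 h2

end Probability

/-! ### Payoffs of concatenated searches -/

section Payoff

variable {Ω X : Type*} [MeasurableSpace Ω] [DecidableEq X] {μ : Measure Ω} {β : X → Ω → Bool}

theorem payoff_nonneg (σ : List X) (h : X) : 0 ≤ payoff μ β σ h := by
  unfold payoff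
  split_ifs
  exacts [pr_nonneg _, le_rfl]

theorem mem_take_idxOf_succ {σ : List X} {h : X} (hh : h ∈ σ) :
    h ∈ σ.take (σ.idxOf h + 1) := by
  have hl := List.idxOf_lt_length_of_mem hh
  rw [List.mem_take_iff_getElem]
  exact ⟨σ.idxOf h, by omega, by simp⟩

theorem payoff_le_pr [IsFiniteMeasure μ] (σ : List X) (h : X) :
    payoff μ β σ h ≤ pr μ β {h} := by
  unfold payoff
  split_ifs with hh
  · exact pr_anti (by simpa using mem_take_idxOf_succ hh)
  · exact pr_nonneg _

theorem payoff_of_notMem {σ : List X} {h : X} (hh : h ∉ σ) : payoff μ β σ h = 0 :=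
  if_neg hh

theorem payoff_append_left {s : List X} (t : List X) {h : X} (hh : h ∈ s) :
    payoff μ β (s ++ t) h = payoff μ β s h := by
  have hl := List.idxOf_lt_length_of_mem hh
  rw [payoff, payoff, if_pos hh, if_pos (List.mem_append_left t hh), List.idxOf_append_of_mem hh,
    List.take_append_of_le_length (by omega)]

theorem payoff_append_right {s t : List X} {h : X} (hs : h ∉ s) (ht : h ∈ t) :
    payoff μ β (s ++ t) h = pr μ β (s.toFinset ∪ (t.take (t.idxOf h + 1)).toFinset) := by
  rw [payoff, if_pos (List.mem_append_right s ht), List.idxOf_append_of_notMem hs,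
    add_assoc, List.take_length_add_append, List.toFinset_append]

theorem payoff_le_append (s t : List X) (h : X) :
    payoff μ β s h ≤ payoff μ β (s ++ t) h := by
  by_cases hh : h ∈ s
  · rw [payoff_append_left t hh]
  · rw [payoff_of_notMem hh]
    exact payoff_nonneg _ _

theorem payoff_concat {s : List X} {x : X} (hx : x ∉ s) (h : X) :
    payoff μ β (s ++ [x]) h =
      payoff μ β s h + if h = x then pr μ β (s ++ [x]).toFinset else 0 := by
  split_ifs with hh
  · subst hh
    rw [payoff_append_right hx (by simp), payoff_of_notMem hx]
    simp
  · by_cases hs : h ∈ s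
    · rw [payoff_append_left _ hs, add_zero]
    · rw [payoff_of_notMem hs, payoff_of_notMem (by simp [hs, hh]), add_zero]

theorem hidePayoff_concat {s : List X} {x : X} (hx : x ∉ s) (y : X →₀ ℝ) :
    hidePayoff μ β (s ++ [x]) y =
      hidePayoff μ β s y + y x * pr μ β (s ++ [x]).toFinset := by
  simp only [hidePayoff, payoff_concat hx, mul_add, Finsupp.sum_add, mul_ite, mul_zero]
  congr 1
  rw [Finsupp.sum_ite_eq']
  split_ifs with h
  · rfl
  · rw [Finsupp.notMem_support_iff.1 h, zero_mul]

theorem hidePayoff_nil (y : X →₀ ℝ) : hidePayoff μ β [] y = 0 := by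
  simp [hidePayoff, payoff]

theorem searchPayoff_eq (p : List X →₀ ℝ) (h : X) :
    searchPayoff μ β p h = Finsupp.linearCombination ℝ (fun σ => payoff μ β σ h) p := by
  simp [searchPayoff, Finsupp.linearCombination_apply]

theorem hidePayoff_eq (σ : List X) (y : X →₀ ℝ) :
    hidePayoff μ β σ y = Finsupp.linearCombination ℝ (payoff μ β σ) y := by
  simp [hidePayoff, Finsupp.linearCombination_apply]

/-- Searching in `B` beforehand costs a factor `c Pr(t)`, which is smallest when `t` exhausts `B`.
-/
theorem ProductRule.le_payoff_append [IsFiniteMeasure μ] {c : ℝ} (hc : 0 ≤ c)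
    {A B : Finset X} (hAB : ProductRule μ β c A B) (hd : Disjoint A B)
    (h1 : c * pr μ β B ≤ 1) {s t : List X} (hs : ∀ x ∈ s, x ∈ A) (ht : ∀ x ∈ t, x ∈ B)
    {h : X} (hh : h ∈ A) : c * pr μ β B * payoff μ β s h ≤ payoff μ β (t ++ s) h := by
  by_cases hm : h ∈ s
  · have hn : h ∉ t := fun h' => Finset.disjoint_left.1 hd hh (ht h h')
    -- The product rule needs a non-empty `t`; for `t = []` nothing is lost, and `c Pr(B) ≤ 1`
    -- suffices.
    rcases t.eq_nil_or_concat with rfl | ⟨t', b, rfl⟩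
    · simpa using mul_le_of_le_one_left (payoff_nonneg s h) h1
    rw [payoff_append_right hn hm, Finset.union_comm,
      hAB _ (fun x hx => hs x (List.mem_of_mem_take (List.mem_toFinset.1 hx))) _
        (fun x hx => ht x (List.mem_toFinset.1 hx))
        ⟨h, List.mem_toFinset.2 (mem_take_idxOf_succ hm)⟩ ⟨b, by simp⟩,
      payoff, if_pos hm]
    have h2 : pr μ β B ≤ pr μ β (t'.concat b).toFinset :=
      pr_anti fun x hx => ht x (List.mem_toFinset.1 hx)
    have h3 : 0 ≤ c * pr μ β (s.take (s.idxOf h + 1)).toFinset := mul_nonneg hc (pr_nonneg _)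
    simp only [List.concat_eq_append] at *
    nlinarith [mul_le_mul_of_nonneg_left h2 h3]
  · rw [payoff_of_notMem hm, mul_zero]
    exact payoff_nonneg _ _

end Payoff

/-! ### Mixed strategies and expectations -/

section Mixed

theorem IsMixed.single {ι : Type*} {S : Set ι} {i : ι} (hi : i ∈ S) :
    IsMixed S (Finsupp.single i 1) := by
  classical
  refine ⟨fun j => ?_, by simp, fun j hj => ?_⟩
  · rw [Finsupp.single_apply]
    split_ifs <;> norm_num
  · rw [Finsupp.mem_support_single] at hj
    exact hj.1 ▸ hi

theorem IsMixed.mono {ι : Type*} {S T : Set ι} {p : ι →₀ ℝ} (h : IsMixed S p) (hST : S ⊆ T) :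
    IsMixed T p :=
  ⟨h.1, h.2.1, fun i hi => hST (h.2.2 i hi)⟩

theorem IsMixed.convex {ι : Type*} {S : Set ι} {p p' : ι →₀ ℝ} {q : ℝ} (h : IsMixed S p)
    (h' : IsMixed S p') (h0 : 0 ≤ q) (h1 : q ≤ 1) : IsMixed S (q • p + (1 - q) • p') := by
  classical
  refine ⟨fun i => ?_, ?_, fun i hi => ?_⟩
  · have := h.1 i
    have := h'.1 i
    have : 0 ≤ 1 - q := by linarith
    simp only [Finsupp.coe_add, Finsupp.coe_smul, Pi.add_apply, Pi.smul_apply, smul_eq_mul]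
    positivity
  · have e : ∀ r : ι →₀ ℝ, (r.sum fun _ a => a) =
        Finsupp.linearCombination ℝ (fun _ => (1 : ℝ)) r := fun r => by
      simp [Finsupp.linearCombination_apply]
    have e1 := h.2.1
    have e2 := h'.2.1
    rw [e] at e1 e2 ⊢
    rw [map_add, map_smul, map_smul, e1, e2]
    simp
  · rcases Finset.mem_union.1 (Finsupp.support_add hi) with hi | hi
    · exact h.2.2 i (Finsupp.support_smul hi)
    · exact h'.2.2 i (Finsupp.support_smul hi)

theorem IsMixed.linearCombination_le {ι : Type*} {S : Set ι} {p : ι →₀ ℝ} (h : IsMixed S p)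
    {f : ι → ℝ} {M : ℝ} (hM : ∀ i ∈ S, f i ≤ M) : Finsupp.linearCombination ℝ f p ≤ M := by
  rw [Finsupp.linearCombination_apply, Finsupp.sum]
  calc ∑ i ∈ p.support, p i • f i ≤ ∑ i ∈ p.support, p i * M :=
        Finset.sum_le_sum fun i hi => mul_le_mul_of_nonneg_left (hM i (h.2.2 i hi)) (h.1 i)
    _ = M := by
        rw [← Finset.sum_mul]
        exact (congrArg (· * M) h.2.1).trans (one_mul M)

theorem IsMixed.le_linearCombination {ι : Type*} {S : Set ι} {p : ι →₀ ℝ} (h : IsMixed S p)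
    {f : ι → ℝ} {M : ℝ} (hM : ∀ i ∈ S, M ≤ f i) : M ≤ Finsupp.linearCombination ℝ f p := by
  have := h.linearCombination_le (f := -f) (M := -M) fun i hi => neg_le_neg (hM i hi)
  have e : Finsupp.linearCombination ℝ (-f) p = -Finsupp.linearCombination ℝ f p := by
    simp [Finsupp.linearCombination_apply, Finsupp.sum]
  linarith

theorem linearCombination_concatMix {X : Type*} (f : List X → ℝ) (p p' : List X →₀ ℝ) :
    Finsupp.linearCombination ℝ f (concatMix p p') =
      Finsupp.linearCombination ℝ
        (fun s => Finsupp.linearCombination ℝ (fun t => f (s ++ t)) p') p := by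
  simp only [concatMix, map_finsuppSum, Finsupp.linearCombination_single, smul_eq_mul]
  simp only [Finsupp.linearCombination_apply, smul_eq_mul, Finsupp.mul_sum, mul_assoc]

theorem linearCombination_concatMix' {X : Type*} (f : List X → ℝ) (p p' : List X →₀ ℝ) :
    Finsupp.linearCombination ℝ f (concatMix p p') =
      Finsupp.linearCombination ℝ
        (fun t => Finsupp.linearCombination ℝ (fun s => f (s ++ t)) p) p' := by
  rw [linearCombination_concatMix]
  simp only [Finsupp.linearCombination_apply, smul_eq_mul, Finsupp.mul_sum]
  rw [Finsupp.sum_comm]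
  simp only [mul_left_comm]

theorem IsMixed.linearCombination_mono {ι : Type*} {S : Set ι} {p : ι →₀ ℝ} (h : IsMixed S p)
    {f g : ι → ℝ} (hfg : ∀ i ∈ S, f i ≤ g i) :
    Finsupp.linearCombination ℝ f p ≤ Finsupp.linearCombination ℝ g p := by
  simp only [Finsupp.linearCombination_apply, Finsupp.sum]
  exact Finset.sum_le_sum fun i hi => mul_le_mul_of_nonneg_left (hfg i (h.2.2 i hi)) (h.1 i)

theorem IsMixed.concatMix {X : Type*} {S S' U : Set (List X)} {p p' : List X →₀ ℝ}
    (h : IsMixed S p) (h' : IsMixed S' p') (hU : ∀ s ∈ S, ∀ t ∈ S', s ++ t ∈ U) :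
    IsMixed U (concatMix p p') := by
  classical
  refine ⟨fun i => ?_, ?_, fun i hi => ?_⟩
  · simp only [SearchRescue.concatMix, Finsupp.sum, Finsupp.coe_finsetSum, Finset.sum_apply]
    refine Finset.sum_nonneg fun s _ => Finset.sum_nonneg fun t _ => ?_
    rw [Finsupp.single_apply]
    split_ifs
    exacts [mul_nonneg (h.1 s) (h'.1 t), le_rfl]
  · have e : ∀ r : List X →₀ ℝ, (r.sum fun _ a => a) =
        Finsupp.linearCombination ℝ (fun _ => (1 : ℝ)) r := fun r => by
      simp [Finsupp.linearCombination_apply]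
    have e1 := h.2.1
    have e2 := h'.2.1
    rw [e] at e1 e2 ⊢
    rw [linearCombination_concatMix, e2, e1]
  · by_contra hn
    refine Finsupp.mem_support_iff.1 hi ?_
    simp only [SearchRescue.concatMix, Finsupp.sum, Finsupp.coe_finsetSum, Finset.sum_apply]
    refine Finset.sum_eq_zero fun s hs => Finset.sum_eq_zero fun t ht => ?_
    exact Finsupp.single_eq_of_ne' fun e => hn (e ▸ hU s (h.2.2 s hs) t (h'.2.2 t ht))

end Mixed

/-! ### Weak duality and scaling of the value -/

section Value

theorem isSearch_iff {X : Type*} [PartialOrder X] (hX : ∀ x y : X, ¬ x < y) {A : Finset X} {σ : List X} :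
    IsSearch A σ ↔ σ.Nodup ∧ ∀ x ∈ σ, x ∈ A :=
  ⟨fun h => ⟨h.1, h.2.1⟩, fun h => ⟨h.1, h.2, List.pairwise_of_forall fun x y => hX y x⟩⟩

variable {Ω X : Type*} [MeasurableSpace Ω] [DecidableEq X]
  {μ : Measure Ω} {β : X → Ω → Bool}

theorem linearCombination_hidePayoff (p : List X →₀ ℝ) (y : X →₀ ℝ) :
    Finsupp.linearCombination ℝ (fun σ => hidePayoff μ β σ y) p =
      Finsupp.linearCombination ℝ (searchPayoff μ β p) y := by
  simp only [Finsupp.linearCombination_apply, hidePayoff, searchPayoff, smul_eq_mul,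
    Finsupp.mul_sum]
  rw [Finsupp.sum_comm]
  simp only [mul_left_comm]

variable [PartialOrder X]

/-- Any amount that Searcher can guarantee is at most the expected payoff against `y`, hence at most
`u`. -/
theorem value_eq_of_guarantees {A : Finset X} {u : ℝ} {p : List X →₀ ℝ} {y : X →₀ ℝ}
    (hp : IsMixed {σ | IsSearch A σ} p) (hpu : ∀ h ∈ A, u ≤ searchPayoff μ β p h)
    (hy : IsMixed {h | h ∈ A} y) (hyu : ∀ σ, IsSearch A σ → hidePayoff μ β σ y ≤ u) :
    value μ β A = u := by
  refine IsGreatest.csSup_eq ⟨⟨p, hp, hpu⟩, ?_⟩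
  rintro v ⟨p', hp', hv⟩
  calc v ≤ Finsupp.linearCombination ℝ (searchPayoff μ β p') y := hy.le_linearCombination hv
    _ = Finsupp.linearCombination ℝ (fun σ => hidePayoff μ β σ y) p' :=
        (linearCombination_hidePayoff p' y).symm
    _ ≤ u := hp'.linearCombination_le hyu

theorem value_le [IsFiniteMeasure μ] {A : Finset X} (hA : A.Nonempty) {M : ℝ} (h0 : 0 ≤ M)
    (hM : ∀ x ∈ A, pr μ β {x} ≤ M) : value μ β A ≤ M := by
  obtain ⟨x, hx⟩ := hA
  refine Real.sSup_le ?_ h0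
  rintro v ⟨p, hp, hv⟩
  refine (hv x hx).trans ?_
  rw [searchPayoff_eq]
  exact hp.linearCombination_le fun σ _ => (payoff_le_pr σ x).trans (hM x hx)

/-- Conditioning on `b` multiplies every payoff in `A` by `c`, since the searched prefixes that
count are non-empty. -/
theorem ProductRule.subValue_eq [Countable X] (hβ : ∀ x, Measurable (β x)) {c : ℝ}
    (hc : 0 < c) {A B : Finset X} (h : ProductRule μ β c A B) {b : X} (hb : b ∈ B)
    (pb : 0 < pr μ β {b}) : subValue μ β A b = c * value μ β A := by
  have h1 : ∀ p, IsMixed {σ | IsSearch A σ} p → ∀ x,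
      searchPayoff (condLaw μ β {b}) β p x = c * searchPayoff μ β p x := by
    intro p hp x
    simp only [searchPayoff, Finsupp.sum, Finset.mul_sum]
    refine Finset.sum_congr rfl fun σ hσ => ?_
    by_cases hx : x ∈ σ
    · have hs := (hp.2.2 σ hσ).2.1
      rw [payoff, payoff, if_pos hx, if_pos hx, ← condPr, h.condPr_eq hβ
        (fun z hz => hs z (List.mem_of_mem_take (List.mem_toFinset.1 hz)))
        ⟨x, List.mem_toFinset.2 (mem_take_idxOf_succ hx)⟩ hb pb]
      ring
    · simp [payoff_of_notMem hx]
  rw [subValue, value, value, ← smul_eq_mul, ← Real.sSup_smul_of_nonneg hc.le]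
  congr 1
  ext v
  rw [Set.mem_smul_set_iff_inv_smul_mem₀ hc.ne']
  refine exists_congr fun p => and_congr_right fun hp => forall₂_congr fun x _ => ?_
  rw [h1 p hp, smul_eq_mul, inv_mul_le_iff₀ hc]

end Value

/-! ### The two coins and interleaved searches at one node -/

section Node

theorem HasOdds.exists_of_nonneg {s t : ℝ} (hs : 0 ≤ s) (ht : 0 ≤ t) : ∃ q, HasOdds q s t := by
  refine ⟨s / (s + t), hs, ht, by positivity, div_le_one_of_le₀ (by linarith) (by positivity), ?_⟩
  rcases (add_nonneg hs ht).eq_or_lt with h | h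
  · have h1 : s = 0 := by linarith
    have h2 : t = 0 := by linarith
    simp [h1, h2]
  · field_simp
    ring

theorem search_odds_eq {c v v' P : ℝ} (hc : 0 < c) (hv : 0 < v) (hv' : 0 < v') :
    1 / (c * v) - c * P / (c * v') = (v' - c * P * v) / (c * v * v') := by
  field_simp

theorem hasOdds_search_iff {c q v v' P P' : ℝ} (hc : 0 < c) (hv : 0 < v) (hv' : 0 < v')
    (h : c * P * v' ≤ v) (h' : c * P' * v ≤ v') :
    HasOdds q (1 / (c * v) - c * P' / (c * v')) (1 / (c * v') - c * P / (c * v)) ↔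
      0 ≤ q ∧ q ≤ 1 ∧ q * (v - c * P * v') = (1 - q) * (v' - c * P' * v) := by
  rw [search_odds_eq hc hv hv', search_odds_eq hc hv' hv, HasOdds]
  have e : q * ((v - c * P * v') / (c * v' * v)) = (1 - q) * ((v' - c * P' * v) / (c * v * v')) ↔
      q * (v - c * P * v') = (1 - q) * (v' - c * P' * v) := by
    field_simp
  rw [e, and_iff_right (div_nonneg (by linarith) (by positivity)),
    and_iff_right (div_nonneg (by linarith) (by positivity))]

theorem hasOdds_hide_iff {c q v v' P P' : ℝ} (hc : 0 < c) (hv : 0 < v) (hv' : 0 < v')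
    (h : c * P ≤ 1) (h' : c * P' ≤ 1) :
    HasOdds q ((1 - c * P) / (c * v)) ((1 - c * P') / (c * v')) ↔
      0 ≤ q ∧ q ≤ 1 ∧ q * (1 - c * P') * v = (1 - q) * (1 - c * P) * v' := by
  rw [HasOdds]
  have e : q * ((1 - c * P') / (c * v')) = (1 - q) * ((1 - c * P) / (c * v)) ↔
      q * (1 - c * P') * v = (1 - q) * (1 - c * P) * v' := by
    field_simp
  rw [e, and_iff_right (div_nonneg (by linarith) (by positivity)),
    and_iff_right (div_nonneg (by linarith) (by positivity))]

/-- With `D = (1 - b) v + (1 - a) v'`, Searcher's odds give `q D = v' - b v`, whence `u = v v' (1 -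
a b) / D`. If `D = 0`, then `a = b = 1`, the bounds force `v = v'`, and any coin will do with `u =
v`. -/
theorem exists_node_value {a b v v' : ℝ} (hv : 0 < v) (hv' : 0 < v') (ha : a ≤ 1)
    (hb : b ≤ 1) (hav : a * v' ≤ v) (hbv : b * v ≤ v') :
    ∃ u, b * v ≤ u ∧
      (∀ q, q * (v - a * v') = (1 - q) * (v' - b * v) →
        u = (q + (1 - q) * b) * v ∧ u = ((1 - q) + q * a) * v') ∧
      (0 < (1 - b) * v + (1 - a) * v' →
        ((1 - b) * v + (1 - a) * v') * u = v * v' * (1 - a * b)) := by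
  have h1 : 0 ≤ (1 - b) * v := mul_nonneg (by linarith) hv.le
  have h2 : 0 ≤ (1 - a) * v' := mul_nonneg (by linarith) hv'.le
  rcases (add_nonneg h1 h2).eq_or_lt with h | h
  · have ha' : a = 1 := by
      have : (1 - a) * v' = 0 := by linarith
      rcases mul_eq_zero.1 this with h | h <;> linarith
    have hb' : b = 1 := by
      have : (1 - b) * v = 0 := by linarith
      rcases mul_eq_zero.1 this with h | h <;> linarith
    subst ha' hb'
    exact ⟨v, by linarith, fun q _ => ⟨by ring, by linarith⟩, fun h' => by linarith⟩
  · refine ⟨v * v' * (1 - a * b) / ((1 - b) * v + (1 - a) * v'), ?_, fun q hq => ⟨?_, ?_⟩,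
      fun _ => mul_div_cancel₀ _ h.ne'⟩
    · rw [le_div_iff₀ h]
      nlinarith [mul_nonneg hv.le (mul_nonneg (sub_nonneg.2 hb) (sub_nonneg.2 hbv))]
    · rw [div_eq_iff h.ne']
      linear_combination (-(v * (1 - b))) * hq
    · rw [div_eq_iff h.ne']
      linear_combination (v' * (1 - a)) * hq

variable {Ω X : Type*} [MeasurableSpace Ω] [DecidableEq X] {μ : Measure Ω} {β : X → Ω → Bool}

/-- `c Pr(s)`, with the convention that it is `1` if nothing is searched. -/
def relPr (μ : Measure Ω) (β : X → Ω → Bool) (c : ℝ) (s : List X) : ℝ :=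
  if s = [] then 1 else c * pr μ β s.toFinset

theorem relPr_nonneg {c : ℝ} (hc : 0 ≤ c) (s : List X) : 0 ≤ relPr μ β c s := by
  unfold relPr
  split_ifs
  exacts [zero_le_one, mul_nonneg hc (pr_nonneg _)]

theorem relPr_concat_le [IsFiniteMeasure μ] {c : ℝ} (hc : 0 ≤ c) (s : List X) {x : X}
    (hx : c * pr μ β {x} ≤ 1) : relPr μ β c (s ++ [x]) ≤ relPr μ β c s := by
  rw [relPr, if_neg (by simp), relPr]
  split_ifs with h
  · simpa [h] using hx
  · exact mul_le_mul_of_nonneg_left (pr_anti (by simp)) hc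

/-- The convention in `relPr` keeps the factorisation valid when `σ` avoids `B`, a case outside the
product rule. -/
theorem ProductRule.pr_eq {c : ℝ} {A B : Finset X} (h : ProductRule μ β c A B)
    {σ : List X} (hσ : ∀ x ∈ σ, x ∈ A ∪ B) (nA : σ.filter (· ∈ A) ≠ []) :
    pr μ β σ.toFinset =
      pr μ β (σ.filter (· ∈ A)).toFinset * relPr μ β c (σ.filter (· ∈ B)) := by
  have e : σ.toFinset = (σ.filter (· ∈ A)).toFinset ∪ (σ.filter (· ∈ B)).toFinset := by
    ext x
    have := hσ x
    simp only [List.mem_toFinset, Finset.mem_union, List.mem_filter, decide_eq_true_eq] at this ⊢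
    tauto
  rw [relPr]
  split_ifs with nB
  · rw [e, nB]
    simp
  · rw [e, h _ (fun x hx => (List.mem_filter.1 (List.mem_toFinset.1 hx)).2 |> of_decide_eq_true) _
      (fun x hx => (List.mem_filter.1 (List.mem_toFinset.1 hx)).2 |> of_decide_eq_true)
      (List.toFinset_nonempty_iff _ |>.2 nA) (List.toFinset_nonempty_iff _ |>.2 nB)]
    ring

theorem ProductRule.relPr_eq {c : ℝ} {A B : Finset X} (h : ProductRule μ β c A B)
    {σ : List X} (hσ : ∀ x ∈ σ, x ∈ A ∪ B) :
    relPr μ β c σ = relPr μ β c (σ.filter (· ∈ A)) * relPr μ β c (σ.filter (· ∈ B)) := by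
  by_cases nA : σ.filter (· ∈ A) = []
  · have e : σ.filter (· ∈ B) = σ := by
      rw [List.filter_eq_nil_iff] at nA
      rw [List.filter_eq_self]
      intro x hx
      have := hσ x hx
      have := nA x hx
      simp_all
    rw [nA, e]
    simp [relPr]
  · have : σ ≠ [] := by
      rintro rfl
      exact nA rfl
    rw [relPr, if_neg this, h.pr_eq hσ nA, ← mul_assoc]
    congr 1
    rw [relPr, if_neg nA]

/-- If in both parts every search has a payoff of at most `l` times the loss of success
probability, then so has every search that interleaves the parts. -/
theorem ProductRule.hidePayoff_le [IsFiniteMeasure μ] {c l : ℝ} (hc : 0 ≤ c) {A B : Finset X}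
    (hd : Disjoint A B) (h : ProductRule μ β c A B)
    (hA : ∀ x ∈ A, c * pr μ β {x} ≤ 1) (hB : ∀ x ∈ B, c * pr μ β {x} ≤ 1)
    {y y' : X →₀ ℝ} (hy : ∀ x ∈ B, y x = 0) (hy' : ∀ x ∈ A, y' x = 0)
    (gA : ∀ s : List X, s.Nodup → (∀ x ∈ s, x ∈ A) →
      hidePayoff μ β s y ≤ l * (1 - relPr μ β c s))
    (gB : ∀ s : List X, s.Nodup → (∀ x ∈ s, x ∈ B) →
      hidePayoff μ β s y' ≤ l * (1 - relPr μ β c s))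
    {σ : List X} (nσ : σ.Nodup) (hσ : ∀ x ∈ σ, x ∈ A ∪ B) :
    hidePayoff μ β σ (y + y') ≤ l * (1 - relPr μ β c σ) := by
  have gA' : ∀ s : List X, s.Nodup →
      0 ≤ l * (1 - relPr μ β c (s.filter (· ∈ A))) - hidePayoff μ β (s.filter (· ∈ A)) y :=
    fun s hs => sub_nonneg.2 (gA _ (hs.filter _) (by simp))
  have gB' : ∀ s : List X, s.Nodup →
      0 ≤ l * (1 - relPr μ β c (s.filter (· ∈ B))) - hidePayoff μ β (s.filter (· ∈ B)) y' :=
    fun s hs => sub_nonneg.2 (gB _ (hs.filter _) (by simp))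
  -- Strengthened claim for prefixes: the slack left in each part, weighted by the success
  -- probability of the other part, is added on the left.
  have key : ∀ s : List X, s.Nodup → (∀ x ∈ s, x ∈ A ∪ B) →
      hidePayoff μ β s (y + y') +
        relPr μ β c (s.filter (· ∈ B)) * (l * (1 - relPr μ β c (s.filter (· ∈ A))) -
          hidePayoff μ β (s.filter (· ∈ A)) y) +
        relPr μ β c (s.filter (· ∈ A)) * (l * (1 - relPr μ β c (s.filter (· ∈ B))) -
          hidePayoff μ β (s.filter (· ∈ B)) y') ≤
      l * (1 - relPr μ β c (s.filter (· ∈ A)) * relPr μ β c (s.filter (· ∈ B))) := by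
    intro s
    induction s using List.reverseRecOn with
    | nil => simp [hidePayoff_nil, relPr]
    | append_singleton s x ih =>
      intro ns hs
      have ns' : s.Nodup := (List.nodup_append.1 ns).1
      have hx : x ∉ s := fun hx => (List.nodup_append.1 ns).2.2 x hx x (by simp) rfl
      have ih := ih ns' fun z hz => hs z (List.mem_append_left _ hz)
      rcases Finset.mem_union.1 (hs x (by simp)) with xA | xB
      · have xB : x ∉ B := Finset.disjoint_left.1 hd xA
        have eA : (s ++ [x]).filter (· ∈ A) = s.filter (· ∈ A) ++ [x] := by
          simp [List.filter_append, xA]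
        have eB : (s ++ [x]).filter (· ∈ B) = s.filter (· ∈ B) := by
          simp [List.filter_append, xB]
        have e := h.pr_eq hs (by rw [eA]; simp)
        rw [eA, eB] at e
        rw [eA, eB, hidePayoff_concat hx, hidePayoff_concat (by simp [hx]), e,
          Finsupp.add_apply, hy' x xA]
        -- The new payoff cancels against the change of the slack in `A`. What remains is that the
        -- weight of the slack in `B` drops, which only lowers the left side.
        have := mul_nonneg (sub_nonneg.2 (relPr_concat_le hc (s.filter (· ∈ A)) (hA x xA)))
          (gB' s ns')
        linarith
      · have xA : x ∉ A := Finset.disjoint_right.1 hd xB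
        have eA : (s ++ [x]).filter (· ∈ A) = s.filter (· ∈ A) := by
          simp [List.filter_append, xA]
        have eB : (s ++ [x]).filter (· ∈ B) = s.filter (· ∈ B) ++ [x] := by
          simp [List.filter_append, xB]
        have e := h.symm.pr_eq (fun z hz => Finset.union_comm A B ▸ hs z hz)
          (by rw [eB]; simp)
        rw [eA, eB] at e
        rw [eA, eB, hidePayoff_concat hx, hidePayoff_concat (by simp [hx]), e,
          Finsupp.add_apply, hy x xB]
        have := mul_nonneg (sub_nonneg.2 (relPr_concat_le hc (s.filter (· ∈ B)) (hB x xB)))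
          (gA' s ns')
        linarith
  rw [h.relPr_eq hσ]
  have := key σ nσ hσ
  have := mul_nonneg (relPr_nonneg (μ := μ) (β := β) hc (σ.filter (· ∈ B))) (gA' σ nσ)
  have := mul_nonneg (relPr_nonneg (μ := μ) (β := β) hc (σ.filter (· ∈ A))) (gB' σ nσ)
  linarith

end Node

/-! ### Induction over the tree -/

section Induction

theorem IsMixed.le_concatMix_left {X : Type*} {S S' : Set (List X)} {p p' : List X →₀ ℝ}
    (h : IsMixed S p) (h' : IsMixed S' p') {f g : List X → ℝ} {k : ℝ}
    (hfg : ∀ s ∈ S, ∀ t ∈ S', k * f s ≤ g (s ++ t)) :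
    k * Finsupp.linearCombination ℝ f p ≤
      Finsupp.linearCombination ℝ g (SearchRescue.concatMix p p') := by
  have e : k * Finsupp.linearCombination ℝ f p =
      Finsupp.linearCombination ℝ (fun s => k * f s) p := by
    simp only [Finsupp.linearCombination_apply, smul_eq_mul, Finsupp.mul_sum, mul_left_comm]
  rw [e, linearCombination_concatMix]
  exact h.linearCombination_mono fun s hs => h'.le_linearCombination fun t ht => hfg s hs t ht

theorem IsMixed.le_concatMix_right {X : Type*} {S S' : Set (List X)} {p p' : List X →₀ ℝ}
    (h : IsMixed S p) (h' : IsMixed S' p') {f g : List X → ℝ} {k : ℝ}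
    (hfg : ∀ s ∈ S, ∀ t ∈ S', k * f t ≤ g (s ++ t)) :
    k * Finsupp.linearCombination ℝ f p' ≤
      Finsupp.linearCombination ℝ g (SearchRescue.concatMix p p') := by
  have e : k * Finsupp.linearCombination ℝ f p' =
      Finsupp.linearCombination ℝ (fun s => k * f s) p' := by
    simp only [Finsupp.linearCombination_apply, smul_eq_mul, Finsupp.mul_sum, mul_left_comm]
  rw [e, linearCombination_concatMix']
  exact h'.linearCombination_mono fun t ht => h.le_linearCombination fun s hs => hfg s hs t ht

theorem SplitTree.leaves_nonempty {X : Type*} [DecidableEq X] :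
    ∀ T : SplitTree X, T.leaves.Nonempty
  | .leaf x => Finset.singleton_nonempty x
  | .node l _ => l.leaves_nonempty.mono Finset.subset_union_left

variable {Ω X : Type*} [MeasurableSpace Ω] [DecidableEq X]

theorem hidePayoff_smul {μ : Measure Ω} {β : X → Ω → Bool} (q : ℝ) (σ : List X) (y : X →₀ ℝ) :
    hidePayoff μ β σ (q • y) = q * hidePayoff μ β σ y := by
  simp [hidePayoff_eq]

/-- The constant of the product rule at the root, if any, is at least `c`. -/
def SplitTree.RootGe (μ : Measure Ω) (β : X → Ω → Bool) (c : ℝ) : SplitTree X → Prop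
  | .leaf _ => True
  | .node l r => ∀ a ∈ l.leaves, ∀ b ∈ r.leaves, c * pr μ β {a} * pr μ β {b} ≤ pr μ β {a, b}

/-- The Bayesian factor is the ratio of the constant `c` above to the constant of the child's own
split, written out with locations. -/
theorem ProductRule.rootGe_of_edgeLeOne [Countable X] {μ : Measure Ω}
    [IsFiniteMeasure μ] {β : X → Ω → Bool} (hβ : ∀ x, Measurable (β x)) (hpos : ∀ x y : X, 0 < pr μ β {x, y}) {c : ℝ}
    {T : SplitTree X} {C : Finset X} (h : ProductRule μ β c T.leaves C) (hC : C.Nonempty)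
    (hT : T.EdgeLeOne μ β C) : T.RootGe μ β c := by
  cases T with
  | leaf x => trivial
  | node l r =>
    intro a ha b hb
    obtain ⟨z, hz⟩ := hC
    have p1 : ∀ x, 0 < pr μ β {x} := fun x => by simpa using hpos x x
    have := hT a ha b hb z hz
    rw [bayesFactor, h.condPr_eq hβ (Finset.singleton_subset_iff.2 (Finset.mem_union_left _ ha)) (by simp)
      hz
      (p1 z), SearchRescue.condPr_eq hβ, ← Finset.insert_eq,
      div_le_one (div_pos (hpos a b) (p1 b)), le_div_iff₀ (p1 b)] at this
    exact this

variable [PartialOrder X]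

/-- A choice of Searcher's coin at the root of each tree. -/
noncomputable def searchCoin (μ : Measure Ω) (β : X → Ω → Bool) : SplitTree X → ℝ
  | .leaf _ => 0
  | .node l r => Classical.epsilon fun q => ∀ a ∈ l.leaves, ∀ b ∈ r.leaves,
      HasOdds q
        (1 / subValue μ β l.leaves b - condPr μ β r.leaves {a} / subValue μ β r.leaves a)
        (1 / subValue μ β r.leaves a - condPr μ β l.leaves {b} / subValue μ β l.leaves b)

/-- A choice of Hider's coin at the root of each tree. -/
noncomputable def hideCoin (μ : Measure Ω) (β : X → Ω → Bool) : SplitTree X → ℝ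
  | .leaf _ => 0
  | .node l r => Classical.epsilon fun q => ∀ a ∈ l.leaves, ∀ b ∈ r.leaves,
      HasOdds q
        ((1 - condPr μ β l.leaves {b}) / subValue μ β l.leaves b)
        ((1 - condPr μ β r.leaves {a}) / subValue μ β r.leaves a)

/-- The tree strategies solve the game on the leaves of `T`, and Hider's strategy bounds the
payoff of every search in terms of its success probability. -/
structure SplitTree.Solved (μ : Measure Ω) (β : X → Ω → Bool) (T : SplitTree X) : Prop where
  pr_pos : 0 < pr μ β T.leaves
  pr_le_value : pr μ β T.leaves ≤ value μ β T.leaves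
  searchCoins : T.SearchCoins μ β (searchCoin μ β)
  hideCoins : T.HideCoins μ β (hideCoin μ β)
  isOptimalSearch : ∀ q, T.SearchCoins μ β q → IsOptimalSearch μ β T.leaves (T.depthFirst q)
  isOptimalHide : ∀ q, T.HideCoins μ β q → IsOptimalHide μ β T.leaves (T.descent q)
  -- `c` is left free because it will be the constant of the parent split, unknown at this stage.
  hidePayoff_mul_le : ∀ q, T.HideCoins μ β q → ∀ c, 0 ≤ c → T.RootGe μ β c →
    c * pr μ β T.leaves ≤ 1 → ∀ σ, IsSearch T.leaves σ → σ ≠ [] →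
      hidePayoff μ β σ (T.descent q) * (1 - c * pr μ β T.leaves) ≤
        value μ β T.leaves * (1 - c * pr μ β σ.toFinset)

variable {μ : Measure Ω} {β : X → Ω → Bool}

theorem SplitTree.solved_leaf [IsFiniteMeasure μ] (hX : ∀ x y : X, ¬ x < y) (x : X)
    (px : 0 < pr μ β {x}) : (SplitTree.leaf x).Solved μ β := by
  have hs : IsMixed {σ | IsSearch {x} σ} (Finsupp.single [x] (1 : ℝ)) :=
    IsMixed.single ((isSearch_iff hX).2 (by simp))
  have hsu : ∀ h ∈ ({x} : Finset X), pr μ β {x} ≤ searchPayoff μ β (Finsupp.single [x] 1) h := by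
    intro h hh
    rw [Finset.mem_singleton.1 hh, searchPayoff_eq]
    simp [payoff]
  have hy : IsMixed {h | h ∈ ({x} : Finset X)} (Finsupp.single x (1 : ℝ)) :=
    IsMixed.single (by simp)
  have hyu : ∀ σ, hidePayoff μ β σ (Finsupp.single x 1) ≤ pr μ β {x} := by
    intro σ
    rw [hidePayoff_eq]
    simpa using payoff_le_pr σ x
  have hv : value μ β {x} = pr μ β {x} := value_eq_of_guarantees hs hsu hy fun σ _ => hyu σ
  refine ⟨px, hv.ge, trivial, trivial, fun q _ => ⟨hs, hv ▸ hsu⟩,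
    fun q _ => ⟨hy, fun σ _ => hv ▸ hyu σ⟩, fun q _ c _ _ h1 σ hσ nσ => ?_⟩
  have e : σ.toFinset = {x} :=
    Finset.Nonempty.subset_singleton_iff ((List.toFinset_nonempty_iff _).2 nσ) |>.1
      fun z hz => hσ.2.1 z (List.mem_toFinset.1 hz)
  simp only [leaves, descent] at h1 ⊢
  rw [e, hv]
  exact mul_le_mul_of_nonneg_right (hyu σ) (by linarith)

theorem ProductRule.mul_value_le_one [IsFiniteMeasure μ] {c : ℝ} (hc : 0 < c)
    {A B : Finset X} (h : ProductRule μ β c A B) (hA : A.Nonempty) {b : X} (hb : b ∈ B)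
    (pb : 0 < pr μ β {b}) : c * value μ β A ≤ 1 := by
  rw [← le_div_iff₀' hc]
  refine value_le hA (by positivity) fun x hx => ?_
  rw [le_div_iff₀' hc]
  exact h.mul_pr_le_one (by simpa using hx) (by simp) hb pb

theorem searchPayoff_node_ge [IsFiniteMeasure μ] {c : ℝ} (hc : 0 ≤ c) {A B : Finset X}
    (h : ProductRule μ β c A B) (hd : Disjoint A B) (h1 : c * pr μ β B ≤ 1)
    {p p' : List X →₀ ℝ} (hp : IsMixed {σ | IsSearch A σ} p)
    (hp' : IsMixed {σ | IsSearch B σ} p') {q v : ℝ} (h0 : 0 ≤ q) (hq : q ≤ 1) {x : X}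
    (hx : x ∈ A) (hv : v ≤ searchPayoff μ β p x) :
    (q + (1 - q) * (c * pr μ β B)) * v ≤
      searchPayoff μ β (q • concatMix p p' + (1 - q) • concatMix p' p) x := by
  have e1 := hp.le_concatMix_left hp' (k := 1) (f := fun σ => payoff μ β σ x)
    (g := fun σ => payoff μ β σ x) fun s _ t _ => by simpa using payoff_le_append s t x
  have e2 := hp'.le_concatMix_right hp (k := c * pr μ β B) (f := fun σ => payoff μ β σ x)
    (g := fun σ => payoff μ β σ x) fun t ht s hs =>
      h.le_payoff_append hc hd h1 hs.2.1 ht.2.1 hx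
  rw [searchPayoff_eq] at hv ⊢
  rw [map_add, map_smul, map_smul, smul_eq_mul, smul_eq_mul]
  have e3 : 0 ≤ q + (1 - q) * (c * pr μ β B) :=
    add_nonneg h0 (mul_nonneg (by linarith) (mul_nonneg hc (pr_nonneg _)))
  have e4 := mul_le_mul_of_nonneg_left hv e3
  have e5 := mul_le_mul_of_nonneg_left e1 h0
  have e6 := mul_le_mul_of_nonneg_left e2 (sub_nonneg.2 hq)
  linarith

theorem IsMixed.eq_zero {ι : Type*} {S : Set ι} {p : ι →₀ ℝ} (h : IsMixed S p) {i : ι}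
    (hi : i ∉ S) : p i = 0 :=
  Finsupp.notMem_support_iff.1 fun hs => hi (h.2.2 i hs)

/-- Hider's odds are those for which the weighted estimates of both children have the same constant
`l = v v' / D`, as interleaving requires. -/
theorem hidePayoff_node_le [IsFiniteMeasure μ] (hX : ∀ x y : X, ¬ x < y) {c : ℝ} (hc : 0 ≤ c)
    {A B : Finset X} (h : ProductRule μ β c A B) (hd : Disjoint A B)
    (hA : ∀ x ∈ A, c * pr μ β {x} ≤ 1) (hB : ∀ x ∈ B, c * pr μ β {x} ≤ 1)
    {y y' : X →₀ ℝ} (hy : IsMixed {h | h ∈ A} y) (hy' : IsMixed {h | h ∈ B} y')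
    {q v v' : ℝ} (hv : 0 < v) (hv' : 0 < v')
    (gA : ∀ s, IsSearch A s → s ≠ [] →
      hidePayoff μ β s y * (1 - c * pr μ β A) ≤ v * (1 - c * pr μ β s.toFinset))
    (gB : ∀ s, IsSearch B s → s ≠ [] →
      hidePayoff μ β s y' * (1 - c * pr μ β B) ≤ v' * (1 - c * pr μ β s.toFinset))
    (hq : q * (1 - c * pr μ β B) * v = (1 - q) * (1 - c * pr μ β A) * v')
    (hD : 0 < (1 - c * pr μ β B) * v + (1 - c * pr μ β A) * v') {σ : List X}
    (hσ : IsSearch (A ∪ B) σ) :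
    ((1 - c * pr μ β B) * v + (1 - c * pr μ β A) * v') *
      hidePayoff μ β σ (q • y + (1 - q) • y') ≤ v * v' * (1 - relPr μ β c σ) := by
  rw [← le_div_iff₀' hD, mul_div_right_comm]
  refine h.hidePayoff_le hc hd hA hB (fun x hx => ?_) (fun x hx => ?_) (fun s ns hs => ?_)
    (fun s ns hs => ?_) hσ.1 hσ.2.1
  · rw [Finsupp.smul_apply, hy.eq_zero (Finset.disjoint_right.1 hd hx), smul_zero]
  · rw [Finsupp.smul_apply, hy'.eq_zero (Finset.disjoint_left.1 hd hx), smul_zero]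
  · rw [hidePayoff_smul, relPr, div_mul_eq_mul_div, le_div_iff₀' hD]
    split_ifs with h0
    · simp [h0, hidePayoff_nil]
    · have := mul_le_mul_of_nonneg_left (gA s ((isSearch_iff hX).2 ⟨ns, hs⟩) h0) hv'.le
      linear_combination this + hidePayoff μ β s y * hq
  · rw [hidePayoff_smul, relPr, div_mul_eq_mul_div, le_div_iff₀' hD]
    split_ifs with h0
    · simp [h0, hidePayoff_nil]
    · have := mul_le_mul_of_nonneg_left (gB s ((isSearch_iff hX).2 ⟨ns, hs⟩) h0) hv.le
      linear_combination this - hidePayoff μ β s y' * hq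

theorem SplitTree.Solved.node [Countable X] [IsFiniteMeasure μ] (hX : ∀ x y : X, ¬ x < y)
    (hβ : ∀ x, Measurable (β x)) {l r : SplitTree X} (hl : l.Solved μ β) (hr : r.Solved μ β)
    {c : ℝ} (hc : 0 < c) (h : ProductRule μ β c l.leaves r.leaves)
    (hd : Disjoint l.leaves r.leaves) (cl : l.RootGe μ β c) (cr : r.RootGe μ β c) :
    (SplitTree.node l r).Solved μ β := by
  obtain ⟨a₀, ha₀⟩ := l.leaves_nonempty
  obtain ⟨b₀, hb₀⟩ := r.leaves_nonempty
  have pl : ∀ a ∈ l.leaves, 0 < pr μ β {a} := fun a ha =>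
    hl.pr_pos.trans_le (pr_anti (by simpa using ha))
  have pr' : ∀ b ∈ r.leaves, 0 < pr μ β {b} := fun b hb =>
    hr.pr_pos.trans_le (pr_anti (by simpa using hb))
  have ql : ∀ x ∈ l.leaves, c * pr μ β {x} ≤ 1 := fun x hx =>
    h.mul_pr_le_one (by simpa using hx) (by simp) hb₀ (pr' _ hb₀)
  have qr : ∀ x ∈ r.leaves, c * pr μ β {x} ≤ 1 := fun x hx =>
    h.symm.mul_pr_le_one (by simpa using hx) (by simp) ha₀ (pl _ ha₀)
  have hP := h _ subset_rfl _ subset_rfl l.leaves_nonempty r.leaves_nonempty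
  have h1l := h.mul_pr_le_one subset_rfl l.leaves_nonempty hb₀ (pr' _ hb₀)
  have h1r := h.symm.mul_pr_le_one subset_rfl r.leaves_nonempty ha₀ (pl _ ha₀)
  have v1l := h.mul_value_le_one hc l.leaves_nonempty hb₀ (pr' _ hb₀)
  have v1r := h.symm.mul_value_le_one hc r.leaves_nonempty ha₀ (pl _ ha₀)
  have ppl := hl.pr_pos
  have ppr := hr.pr_pos
  have pvl := hl.pr_le_value
  have pvr := hr.pr_le_value
  have vl := ppl.trans_le pvl
  have vr := ppr.trans_le pvr
  -- Non-negativity of Searcher's odds: `c V(B) ≤ 1` and `Pr(A) ≤ V(A)`.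
  have hav : c * pr μ β l.leaves * value μ β r.leaves ≤ value μ β l.leaves := by
    nlinarith [mul_le_mul_of_nonneg_left v1r ppl.le]
  have hbv : c * pr μ β r.leaves * value μ β l.leaves ≤ value μ β r.leaves := by
    nlinarith [mul_le_mul_of_nonneg_left v1l ppr.le]
  have oddsS : ∀ q, (∀ a ∈ l.leaves, ∀ b ∈ r.leaves, HasOdds q
        (1 / subValue μ β l.leaves b - condPr μ β r.leaves {a} / subValue μ β r.leaves a)
        (1 / subValue μ β r.leaves a - condPr μ β l.leaves {b} / subValue μ β l.leaves b)) ↔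
      HasOdds q (1 / (c * value μ β l.leaves) - c * pr μ β r.leaves / (c * value μ β r.leaves))
        (1 / (c * value μ β r.leaves) - c * pr μ β l.leaves / (c * value μ β l.leaves)) := by
    intro q
    have e : ∀ a ∈ l.leaves, ∀ b ∈ r.leaves, HasOdds q
        (1 / subValue μ β l.leaves b - condPr μ β r.leaves {a} / subValue μ β r.leaves a)
        (1 / subValue μ β r.leaves a - condPr μ β l.leaves {b} / subValue μ β l.leaves b) ↔
      HasOdds q (1 / (c * value μ β l.leaves) - c * pr μ β r.leaves / (c * value μ β r.leaves))
        (1 / (c * value μ β r.leaves) -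
          c * pr μ β l.leaves / (c * value μ β l.leaves)) := fun a ha b hb => by
      rw [h.subValue_eq hβ hc hb (pr' b hb), h.symm.subValue_eq hβ hc ha (pl a ha),
        h.condPr_eq hβ subset_rfl l.leaves_nonempty hb (pr' b hb),
        h.symm.condPr_eq hβ subset_rfl r.leaves_nonempty ha (pl a ha)]
    exact ⟨fun H => (e a₀ ha₀ b₀ hb₀).1 (H a₀ ha₀ b₀ hb₀),
      fun H a ha b hb => (e a ha b hb).2 H⟩
  have oddsH : ∀ q, (∀ a ∈ l.leaves, ∀ b ∈ r.leaves, HasOdds q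
        ((1 - condPr μ β l.leaves {b}) / subValue μ β l.leaves b)
        ((1 - condPr μ β r.leaves {a}) / subValue μ β r.leaves a)) ↔
      HasOdds q ((1 - c * pr μ β l.leaves) / (c * value μ β l.leaves))
        ((1 - c * pr μ β r.leaves) / (c * value μ β r.leaves)) := by
    intro q
    have e : ∀ a ∈ l.leaves, ∀ b ∈ r.leaves, HasOdds q
        ((1 - condPr μ β l.leaves {b}) / subValue μ β l.leaves b)
        ((1 - condPr μ β r.leaves {a}) / subValue μ β r.leaves a) ↔
      HasOdds q ((1 - c * pr μ β l.leaves) / (c * value μ β l.leaves))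
        ((1 - c * pr μ β r.leaves) / (c * value μ β r.leaves)) := fun a ha b hb => by
      rw [h.subValue_eq hβ hc hb (pr' b hb), h.symm.subValue_eq hβ hc ha (pl a ha),
        h.condPr_eq hβ subset_rfl l.leaves_nonempty hb (pr' b hb),
        h.symm.condPr_eq hβ subset_rfl r.leaves_nonempty ha (pl a ha)]
    exact ⟨fun H => (e a₀ ha₀ b₀ hb₀).1 (H a₀ ha₀ b₀ hb₀),
      fun H a ha b hb => (e a ha b hb).2 H⟩
  have coinsS : (SplitTree.node l r).SearchCoins μ β (searchCoin μ β) := by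
    refine ⟨?_, hl.searchCoins, hr.searchCoins⟩
    refine Classical.epsilon_spec (p := fun q : ℝ => ∀ a ∈ l.leaves, ∀ b ∈ r.leaves, HasOdds q
        (1 / subValue μ β l.leaves b - condPr μ β r.leaves {a} / subValue μ β r.leaves a)
        (1 / subValue μ β r.leaves a - condPr μ β l.leaves {b} / subValue μ β l.leaves b)) ?_
    simp only [oddsS]
    refine HasOdds.exists_of_nonneg ?_ ?_
    · rw [search_odds_eq hc vl vr]
      exact div_nonneg (by linarith) (by positivity)
    · rw [search_odds_eq hc vr vl]
      exact div_nonneg (by linarith) (by positivity)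
  have coinsH : (SplitTree.node l r).HideCoins μ β (hideCoin μ β) := by
    refine ⟨?_, hl.hideCoins, hr.hideCoins⟩
    refine Classical.epsilon_spec (p := fun q : ℝ => ∀ a ∈ l.leaves, ∀ b ∈ r.leaves, HasOdds q
        ((1 - condPr μ β l.leaves {b}) / subValue μ β l.leaves b)
        ((1 - condPr μ β r.leaves {a}) / subValue μ β r.leaves a)) ?_
    simp only [oddsH]
    exact HasOdds.exists_of_nonneg (div_nonneg (by linarith) (by positivity))
      (div_nonneg (by linarith) (by positivity))
  obtain ⟨u, hu, huS, huH⟩ := exists_node_value vl vr h1l h1r hav hbv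
  have hPu : c * pr μ β l.leaves * pr μ β r.leaves ≤ u := by
    refine le_trans ?_ hu
    have := mul_le_mul_of_nonneg_left pvl (mul_pos hc ppr).le
    linarith
  have solS : ∀ q, (SplitTree.node l r).SearchCoins μ β q →
      IsMixed {σ | IsSearch (l.leaves ∪ r.leaves) σ} ((SplitTree.node l r).depthFirst q) ∧
      ∀ x ∈ l.leaves ∪ r.leaves, u ≤ searchPayoff μ β ((SplitTree.node l r).depthFirst q) x := by
    rintro q ⟨h0, hql, hqr⟩
    rw [oddsS, hasOdds_search_iff hc vl vr hav hbv] at h0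
    obtain ⟨q0, q1, hq⟩ := h0
    obtain ⟨ml, gl⟩ := hl.isOptimalSearch q hql
    obtain ⟨mr, gr⟩ := hr.isOptimalSearch q hqr
    obtain ⟨e1, e2⟩ := huS _ hq
    constructor
    · refine IsMixed.convex (ml.concatMix mr ?_) (mr.concatMix ml ?_) q0 q1
      · intro s hs t ht
        refine (isSearch_iff hX).2 ⟨List.nodup_append.2 ⟨hs.1, ht.1, ?_⟩, fun x hx => ?_⟩
        · exact fun x hx y hy e =>
            Finset.disjoint_left.1 hd (hs.2.1 x hx) (e ▸ ht.2.1 y hy)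
        · exact Finset.mem_union.2 ((List.mem_append.1 hx).imp (hs.2.1 x) (ht.2.1 x))
      · intro s hs t ht
        refine (isSearch_iff hX).2 ⟨List.nodup_append.2 ⟨hs.1, ht.1, ?_⟩, fun x hx => ?_⟩
        · exact fun x hx y hy e =>
            Finset.disjoint_right.1 hd (hs.2.1 x hx) (e ▸ ht.2.1 y hy)
        · exact Finset.mem_union.2 ((List.mem_append.1 hx).symm.imp (ht.2.1 x) (hs.2.1 x))
    · intro x hx
      rcases Finset.mem_union.1 hx with hx | hx
      · rw [e1]
        exact searchPayoff_node_ge hc.le h hd h1r ml mr q0 q1 hx (gl x hx)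
      · rw [e2]
        have := searchPayoff_node_ge hc.le h.symm hd.symm h1l mr ml (sub_nonneg.2 q1)
          (sub_le_self 1 q0) hx (gr x hx)
        rw [sub_sub_cancel, add_comm (_ • _) (_ • _)] at this
        exact this
  have solH : ∀ q, (SplitTree.node l r).HideCoins μ β q →
      IsMixed {x | x ∈ l.leaves ∪ r.leaves} ((SplitTree.node l r).descent q) ∧
      ∀ σ, IsSearch (l.leaves ∪ r.leaves) σ →
        hidePayoff μ β σ ((SplitTree.node l r).descent q) ≤ u ∧
        (σ ≠ [] → hidePayoff μ β σ ((SplitTree.node l r).descent q) *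
          (1 - c * (c * pr μ β l.leaves * pr μ β r.leaves)) ≤
            u * (1 - c * pr μ β σ.toFinset)) := by
    rintro q ⟨h0, hql, hqr⟩
    rw [oddsH, hasOdds_hide_iff hc vl vr h1l h1r] at h0
    obtain ⟨q0, q1, hq⟩ := h0
    obtain ⟨ml, gl⟩ := hl.isOptimalHide q hql
    obtain ⟨mr, gr⟩ := hr.isOptimalHide q hqr
    have mix : IsMixed {x | x ∈ l.leaves ∪ r.leaves} ((SplitTree.node l r).descent q) :=
      (ml.mono fun x hx => Finset.mem_union_left _ hx).convex
        (mr.mono fun x hx => Finset.mem_union_right _ hx) q0 q1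
    refine ⟨mix, fun σ hσ => ?_⟩
    have u0 : 0 ≤ u := le_trans (by positivity) hPu
    have d1 : 0 ≤ (1 - c * pr μ β r.leaves) * value μ β l.leaves :=
      mul_nonneg (by linarith) vl.le
    have d2 : 0 ≤ (1 - c * pr μ β l.leaves) * value μ β r.leaves :=
      mul_nonneg (by linarith) vr.le
    rcases (add_nonneg d1 d2).eq_or_lt with hD | hD
    -- Odds `0 : 0`: here `u ≥ c Pr(A) Pr(B) = 1 / c`, while no single location succeeds with
    -- probability above `1 / c`.
    · have er : 1 - c * pr μ β r.leaves = 0 :=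
        (mul_eq_zero.1 (show (1 - c * pr μ β r.leaves) * value μ β l.leaves = 0 by
          linarith)).resolve_right vl.ne'
      have el : 1 - c * pr μ β l.leaves = 0 :=
        (mul_eq_zero.1 (show (1 - c * pr μ β l.leaves) * value μ β r.leaves = 0 by
          linarith)).resolve_right vr.ne'
      have q2 : ∀ x ∈ l.leaves ∪ r.leaves, c * pr μ β {x} ≤ 1 := fun x hx =>
        (Finset.mem_union.1 hx).elim (ql x) (qr x)
      constructor
      · rw [hidePayoff_eq]
        refine mix.linearCombination_le fun x hx => (payoff_le_pr σ x).trans ?_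
        have := q2 x hx
        refine le_of_mul_le_mul_left (this.trans ?_) hc
        have := mul_le_mul_of_nonneg_left hPu hc.le
        linear_combination this + c * pr μ β r.leaves * el + er
      · intro nσ
        obtain ⟨x, hx⟩ := List.exists_mem_of_ne_nil σ nσ
        have e1 : c * pr μ β σ.toFinset ≤ 1 :=
          (mul_le_mul_of_nonneg_left (pr_anti (by simpa using hx)) hc.le).trans
            (q2 x (hσ.2.1 x hx))
        have e2 := mul_nonneg u0 (sub_nonneg.2 e1)
        linear_combination e2 + hidePayoff μ β σ ((SplitTree.node l r).descent q) *
          (er + c * pr μ β r.leaves * el)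
    · have key := hidePayoff_node_le hX hc.le h hd ql qr ml mr vl vr
        (hl.hidePayoff_mul_le q hql c hc.le cl h1l) (hr.hidePayoff_mul_le q hqr c hc.le cr h1r)
        hq hD hσ
      have hu' := huH hD
      have hab : 0 ≤ 1 - c * pr μ β l.leaves * (c * pr μ β r.leaves) := by
        nlinarith [mul_pos hc ppl, mul_pos hc ppr]
      constructor
      · refine le_of_mul_le_mul_left (key.trans ?_) hD
        rw [hu']
        refine mul_le_mul_of_nonneg_left (sub_le_sub_left ?_ _) (by positivity)
        rw [relPr]
        split_ifs with nσ
        · linarith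
        · have : pr μ β (l.leaves ∪ r.leaves) ≤ pr μ β σ.toFinset :=
            pr_anti fun x hx => hσ.2.1 x (List.mem_toFinset.1 hx)
          rw [hP] at this
          linarith [mul_le_mul_of_nonneg_left this hc.le]
      · intro nσ
        rw [relPr, if_neg nσ] at key
        refine le_of_mul_le_mul_left ?_ hD
        -- `1 - a b` is both `1 - c Pr(A ∪ B)` and the factor in `D u = v v' (1 - a b)`.
        have := mul_le_mul_of_nonneg_right key hab
        have e : descent q (SplitTree.node l r) = q (SplitTree.node l r) • descent q l +
          (1 - q (SplitTree.node l r)) • descent q r := rfl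
        rw [← e] at this
        linear_combination this - (1 - c * pr μ β σ.toFinset) * hu'
  obtain ⟨mS, gS⟩ := solS _ coinsS
  obtain ⟨mH, gH⟩ := solH _ coinsH
  have hv : value μ β (l.leaves ∪ r.leaves) = u :=
    value_eq_of_guarantees mS gS mH fun σ hσ => (gH σ hσ).1
  refine ⟨?_, ?_, coinsS, coinsH, fun q hq => ?_, fun q hq => ?_, ?_⟩
  · rw [leaves, hP]
    positivity
  · rw [leaves, hP, hv]
    exact hPu
  · exact ⟨(solS q hq).1, hv ▸ (solS q hq).2⟩
  · exact ⟨(solH q hq).1, fun σ hσ => hv ▸ ((solH q hq).2 σ hσ).1⟩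
  · intro q hq c' hc' hroot _ σ hσ nσ
    rw [leaves, hP, hv]
    obtain ⟨e1, e2⟩ := (solH q hq).2 σ hσ
    have e2 := e2 nσ
    have hcc : c' ≤ c := by
      have := hroot a₀ ha₀ b₀ hb₀
      rw [Finset.insert_eq, h _ (by simpa using ha₀) _ (by simpa using hb₀) (by simp) (by simp),
        mul_assoc, mul_assoc] at this
      exact le_of_mul_le_mul_right this (mul_pos (pl _ ha₀) (pr' _ hb₀))
    refine le_of_mul_le_mul_left ?_ hc
    -- The estimate for `c'` interpolates between that for `0`, the bound by `u`, and that for `c`,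
    -- with weights `c - c'` and `c'`.
    have e3 := mul_le_mul_of_nonneg_left e1 (sub_nonneg.2 hcc)
    have e4 := mul_le_mul_of_nonneg_left e2 hc'
    linear_combination e3 + e4

theorem SplitTree.solved [Countable X] [IsFiniteMeasure μ] (hX : ∀ x y : X, ¬ x < y)
    (hβ : ∀ x, Measurable (β x)) (hpos : ∀ x y : X, 0 < pr μ β {x, y}) (T : SplitTree X)
    (hT : T.IsCoIndep μ β) (hf : T.FactorsLeOne μ β) : T.Solved μ β := by
  induction T with
  | leaf x => exact solved_leaf hX x (by simpa using hpos x x)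
  | node l r ihl ihr =>
    obtain ⟨hlr, hl, hr⟩ := hT
    obtain ⟨fl, fr, hfl, hfr⟩ := hf
    obtain ⟨c, hc, h⟩ := hlr.exists_productRule hβ hpos l.leaves_nonempty r.leaves_nonempty
    exact (ihl hl hfl).node hX hβ (ihr hr hfr) hc h hlr.1
      (h.rootGe_of_edgeLeOne hβ hpos r.leaves_nonempty fl)
      (h.symm.rootGe_of_edgeLeOne hβ hpos l.leaves_nonempty fr)

end Induction

/-! ### Existence of a decomposition, and the theorem -/

theorem CompletelyReducible.exists_isDecomposition {Ω X : Type*} [MeasurableSpace Ω]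
    [DecidableEq X] {μ : Measure Ω} {β : X → Ω → Bool} {A : Finset X}
    (h : CompletelyReducible μ β A) :
    ∀ Y ⊆ A, Y.Nonempty → ∃ T, IsDecomposition μ β Y T := by
  intro Y
  induction Y using Finset.strongInduction with
  | H Y ih =>
    intro hY nY
    rcases Nat.lt_or_ge Y.card 2 with h2 | h2
    · obtain ⟨x, rfl⟩ := Finset.card_eq_one.1 (by have := nY.card_pos; omega : Y.card = 1)
      exact ⟨.leaf x, rfl, trivial⟩
    · obtain ⟨B, C, nB, nC, rfl, hBC⟩ := h Y hY h2
      have hB : B ⊂ B ∪ C := Finset.subset_union_left.ssubset_of_ne fun e => by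
        obtain ⟨x, hx⟩ := nC
        exact Finset.disjoint_right.1 hBC.1 hx (e ▸ Finset.mem_union_right B hx)
      have hC : C ⊂ B ∪ C := Finset.subset_union_right.ssubset_of_ne fun e => by
        obtain ⟨x, hx⟩ := nB
        exact Finset.disjoint_left.1 hBC.1 hx (e ▸ Finset.mem_union_left C hx)
      obtain ⟨l, rfl, hl⟩ := ih B hB (hB.subset.trans hY) nB
      obtain ⟨r, rfl, hr⟩ := ih C hC (hC.subset.trans hY) nC
      exact ⟨.node l r, rfl, hBC, hl, hr⟩

end SearchRescue

theorem mainTheorem6 {Ω X : Type*} [MeasurableSpace Ω] [Fintype X] [DecidableEq X] [Nonempty X]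
    [PartialOrder X] (hX : ∀ x y : X, ¬ x < y)
    (μ : MeasureTheory.Measure Ω) [MeasureTheory.IsProbabilityMeasure μ]
    (β : X → Ω → Bool) (hβ : ∀ x, Measurable (β x))
    (hpos : ∀ x y : X, 0 < SearchRescue.pr μ β {x, y})
    (hred : SearchRescue.CompletelyReducible μ β Finset.univ) :
    (∃ T, SearchRescue.IsDecomposition μ β Finset.univ T) ∧
    ∀ T, SearchRescue.IsDecomposition μ β Finset.univ T → T.FactorsLeOne μ β →
      ((∃ q, T.SearchCoins μ β q) ∧
        ∀ q, T.SearchCoins μ β q →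
          SearchRescue.IsOptimalSearch μ β Finset.univ (T.depthFirst q)) ∧
      ((∃ q, T.HideCoins μ β q) ∧
        ∀ q, T.HideCoins μ β q →
          SearchRescue.IsOptimalHide μ β Finset.univ (T.descent q)) := by
  refine ⟨hred.exists_isDecomposition _ subset_rfl Finset.univ_nonempty, ?_⟩
  rintro T ⟨hT, hco⟩ hf
  have h := T.solved hX hβ hpos hco hf
  rw [← hT]
  exact ⟨⟨⟨_, h.searchCoins⟩, h.isOptimalSearch⟩, ⟨_, h.hideCoins⟩, h.isOptimalHide⟩
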